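/- Let $\mathbf V=(X_i)_{i\in V}$ be finitely many random variables, $X_i$ with values in a standard Borel space equipped with a $\sigma$-finite reference measure $\nu_i$ (for instance $\mathbb R$ with Lebesgue measure, or a countable set with counting measure), and suppose that their joint distribution $P$ has a density with respect to $\bigotimes_i\nu_i$. For $S\subseteq V$ let $p_S$ be the density of the marginal distribution of $X_S=(X_i)_{i\in S}$ with respect to $\bigotimes_{i\in S}\nu_i$, and for $T\in V$, $S\subseteq V\setminus\{T\}$, let $$H(T\mid S)=-\mathbb E\Big[\log\frac{p_{S\cup\{T\}}(X_{S\cup\{T\}})}{p_S(X_S)}\Big]$$ be the conditional entropy (differential entropy for Lebesgue measures, Shannon entropy for counting measures). Let $\mathcal G$ be a directed acyclic graph whose vertex set is $V$ (causal sufficiency: there are no latent variables), and suppose that $\mathcal G$ and $P$ are faithful to each other: for all pairwise disjoint $A,B,C\subseteq V$, $X_A$ and $X_B$ are conditionally independent given $X_C$ under $P$ if and only if $C$ d-separates $A$ from $B$ in $\mathcal G$. For $T\in V$ let the Markov boundary $\mathcal{MB}_T=Pa_T\cup Ch_T\cup Sp_T$ consist of the parents of $T$, the children of $T$, and the spouses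 of $T$ (the other parents of the children of $T$). **Theorem.** Fix $T\in V$ and assume that the conditional entropies $H(T\mid S)$, $S\subseteq V\setminus\{T\}$, are all finite (that is, the logarithm in the display above is integrable). Then $\mathcal{MB}_T$ is the unique inclusion-minimal element of the family of all sets $S\subseteq V\setminus\{T\}$ that minimize $H(T\mid S)$ over the subsets of $V\setminus\{T\}$. Furthermore, $H(T\mid S')=H(T\mid\mathcal{MB}_T)$ for every $S'$ with $\mathcal{MB}_T\subseteq S'\subseteq V\setminus\{T\}$. -/

import Mathlib

open MeasureTheory ProbabilityTheory

noncomputable section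

namespace MarkovBoundary

section Graph

variable {ι : Type*}

/-- A directed graph is acyclic if no vertex can be reached from itself along a nonempty directed
path. -/
def IsDAG (G : Digraph ι) : Prop :=
  ∀ v, ¬ Relation.TransGen G.Adj v v

/-- The middle vertex `v` of three consecutive vertices `u, v, w` of a path lets information
through given `C`: a collider `u → v ← w` does so iff it or one of its descendants lies in `C`;
any other (chain or fork) vertex does so iff it does not lie in `C`. -/
def IsOpenTriple (G : Digraph ι) (C : Finset ι) (u v w : ι) : Prop :=
  ((G.Adj u v ∧ G.Adj w v) → ∃ d ∈ C, Relation.ReflTransGen G.Adj v d) ∧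
  (¬ (G.Adj u v ∧ G.Adj w v) → v ∉ C)

/-- A walk in the skeleton of `G` (the graph that forgets the direction of the edges) is active
given `C` if each of its interior vertices is open given `C`. -/
def IsActive (G : Digraph ι) (C : Finset ι) {a b : ι}
    (p : G.toSimpleGraphInclusive.Walk a b) : Prop :=
  ∀ k, k + 2 ≤ p.length →
    IsOpenTriple G C (p.getVert k) (p.getVert (k + 1)) (p.getVert (k + 2))

/-- `C` d-separates `A` from `B` in `G`: every path (without repeated vertices) in the skeleton
of `G` from a vertex of `A` to a vertex of `B` is blocked by `C`. It is used for pairwise disjoint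
sets only. -/
def DSep (G : Digraph ι) (A B C : Finset ι) : Prop :=
  ∀ a ∈ A, ∀ b ∈ B, ∀ p : G.toSimpleGraphInclusive.Walk a b, p.IsPath → ¬ IsActive G C p

/-- The parents of `T`. -/
def parents [Fintype ι] (G : Digraph ι) (T : ι) : Finset ι :=
  open Classical in Finset.univ.filter fun v => G.Adj v T

/-- The children of `T`. -/
def children [Fintype ι] (G : Digraph ι) (T : ι) : Finset ι :=
  open Classical in Finset.univ.filter fun v => G.Adj T v

/-- The co-parents (spouses) of `T`: the other vertices that share a child with `T`. -/
def spouses [Fintype ι] (G : Digraph ι) (T : ι) : Finset ι :=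
  open Classical in Finset.univ.filter fun v => v ≠ T ∧ ∃ c, G.Adj T c ∧ G.Adj v c

/-- The Markov boundary of `T`: its parents, its children and its spouses. -/
def markovBoundary [Fintype ι] [DecidableEq ι] (G : Digraph ι) (T : ι) : Finset ι :=
  parents G T ∪ children G T ∪ spouses G T

end Graph

section Probability

variable {ι : Type*} [Fintype ι] {E : ι → Type*} [∀ i, MeasurableSpace (E i)]

/-- Under the joint law `P` of the variables (the coordinates of `∀ i, E i`), the subvectors
indexed by `A` and by `B` are conditionally independent given the subvector indexed by `C`. -/
def CondIndepVars [∀ i, StandardBorelSpace (E i)] (P : Measure (∀ i, E i)) [IsFiniteMeasure P]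
    (A B C : Finset ι) : Prop :=
  CondIndepFun (MeasurableSpace.comap (C.restrict (π := E)) inferInstance)
    (Finset.measurable_restrict C).comap_le (A.restrict (π := E)) (B.restrict (π := E)) P

/-- The directed graph `G` and the joint law `P` are faithful to each other: for pairwise disjoint
sets of variables, the conditional independences of `P` are exactly the d-separations of `G`. -/
def Faithful [∀ i, StandardBorelSpace (E i)] (G : Digraph ι) (P : Measure (∀ i, E i))
    [IsFiniteMeasure P] : Prop :=
  ∀ A B C : Finset ι, Disjoint A B → Disjoint A C → Disjoint B C →
    (CondIndepVars P A B C ↔ DSep G A B C)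

/-- The joint density of the variables indexed by `S`, with respect to the product of their
reference measures, evaluated at the `S`-coordinates of `x`. -/
def density (ν : ∀ i, Measure (E i)) (P : Measure (∀ i, E i)) (S : Finset ι) (x : ∀ i, E i) : ℝ :=
  ((P.map (S.restrict (π := E))).rnDeriv (Measure.pi fun i : S => ν i) (S.restrict x)).toReal

/-- The logarithm of the conditional density `p(t ∣ s) = p(t, s) / p(s)` of the variable `T` given
the variables indexed by `S`, evaluated at `x`. -/
def logCondDensity [DecidableEq ι] (ν : ∀ i, Measure (E i)) (P : Measure (∀ i, E i)) (T : ι)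
    (S : Finset ι) (x : ∀ i, E i) : ℝ :=
  Real.log (density ν P (insert T S) x / density ν P S x)

/-- The conditional entropy `H(T ∣ S) = - 𝔼 [log p(T ∣ S)]`: differential entropy when the reference
measures are Lebesgue measures, Shannon entropy when they are counting measures. -/
def condEntropy [DecidableEq ι] (ν : ∀ i, Measure (E i)) (P : Measure (∀ i, E i)) (T : ι)
    (S : Finset ι) : ℝ :=
  - ∫ x, logCondDensity ν P T S x ∂P

/-- `S` is a set of variables other than `T` that minimizes the conditional entropy `H(T ∣ S)`
among all such sets. -/
def MinimizesCondEntropy [DecidableEq ι] (ν : ∀ i, Measure (E i)) (P : Measure (∀ i, E i)) (T : ι)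
    (S : Finset ι) : Prop :=
  S ⊆ Finset.univ.erase T ∧
    ∀ S' ⊆ Finset.univ.erase T, condEntropy ν P T S ≤ condEntropy ν P T S'

end Probability

end MarkovBoundary

end

noncomputable section

namespace MarkovBoundary

/-! ### d-separation and the Markov boundary -/

section Graph

variable {ι : Type*} {G : Digraph ι}

/-! For `S ⊆ S'` not containing `T`, the drop `H(T ∣ S) - H(T ∣ S')` is the conditional mutual
information of `T` and `S' \ S` given `S`. It is the Kullback-Leibler divergence of the joint law
from the law with the same `(S, T)`- and `(S, S' \ S)`-marginals under which the two blocks are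
conditionally independent given `S`. So it is nonnegative, and zero exactly under conditional
independence (`integral_log_condDensity_le`, `condEntropy_union_le`), which by faithfulness means
that `S` d-separates `T` from `S' \ S`.

Hence the set of all other vertices is a minimizer, and `S` is one iff it d-separates `T` from all
the rest. What remains is graph theory: the Markov boundary d-separates `T` from everything outside
it (`IsDAG.dSep_markovBoundary`), and every set that separates `T` from its complement contains the
boundary (`IsDAG.markovBoundary_subset_of_dSep`). The boundary is thus the least minimizer. -/

theorem IsDAG.irrefl (hG : IsDAG G) (v : ι) : ¬ G.Adj v v :=
  fun h => hG v (.single h)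

theorem IsDAG.asymm (hG : IsDAG G) {u v : ι} (h : G.Adj u v) : ¬ G.Adj v u :=
  fun h' => hG u (.tail (.single h) h')

theorem skeleton_adj {u v : ι} : G.toSimpleGraphInclusive.Adj u v ↔
    u ≠ v ∧ (G.Adj u v ∨ G.Adj v u) :=
  SimpleGraph.fromRel_adj _ _ _

theorem mem_markovBoundary [Fintype ι] [DecidableEq ι] {T v : ι} :
    v ∈ markovBoundary G T ↔
      G.Adj v T ∨ G.Adj T v ∨ (v ≠ T ∧ ∃ c, G.Adj T c ∧ G.Adj v c) := by
  simp [markovBoundary, parents, children, spouses]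

theorem IsDAG.markovBoundary_subset [Fintype ι] [DecidableEq ι] (hG : IsDAG G) (T : ι) :
    markovBoundary G T ⊆ Finset.univ.erase T := by
  intro v hv
  rw [mem_markovBoundary] at hv
  simp only [Finset.mem_erase, Finset.mem_univ, and_true]
  rintro rfl
  rcases hv with h | h | h
  · exact hG.irrefl _ h
  · exact hG.irrefl _ h
  · exact h.1 rfl

/-- The Markov boundary of `T` d-separates `T` from all remaining vertices. -/
theorem IsDAG.dSep_markovBoundary [Fintype ι] [DecidableEq ι] (hG : IsDAG G) (T : ι)
    {B : Finset ι} (hB : Disjoint B (markovBoundary G T)) (hT : T ∉ B) :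
    DSep G {T} B (markovBoundary G T) := by
  intro a ha b hb p hp hact
  obtain rfl : a = T := by simpa using ha
  have hbM : b ∉ markovBoundary G a := Finset.disjoint_left.1 hB hb
  cases p with
  | nil => exact hT hb
  | @cons _ v₁ _ h₁ q =>
    have hv₁ : v₁ ∈ markovBoundary G a := by
      rw [mem_markovBoundary]
      rcases (skeleton_adj.1 h₁).2 with h | h <;> simp [h]
    cases q with
    | nil => exact hbM hv₁
    | @cons _ v₂ _ h₂ r =>
      have o₁ := hact 0 (by simp)
      simp only [IsOpenTriple, SimpleGraph.Walk.getVert_cons_succ,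
        SimpleGraph.Walk.getVert_zero, zero_add] at o₁
      -- A neighbour of `T` lies in the conditioning set, so the path can pass it only as a
      -- collider; this makes `v₂` a spouse.
      have hcol : G.Adj a v₁ ∧ G.Adj v₂ v₁ := by
        by_contra h
        exact o₁.2 h hv₁
      have hne : v₂ ≠ a := by
        rintro rfl
        simp [SimpleGraph.Walk.cons_isPath_iff] at hp
      have hv₂ : v₂ ∈ markovBoundary G a :=
        mem_markovBoundary.2 (.inr (.inr ⟨hne, v₁, hcol⟩))
      cases r with
      | nil => exact hbM hv₂
      | @cons _ v₃ _ h₃ s =>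
        have o₂ := hact 1 (by simp)
        simp only [IsOpenTriple, SimpleGraph.Walk.getVert_cons_succ,
          SimpleGraph.Walk.getVert_zero] at o₂
        -- The edge `v₂ → v₁` leaves `v₂`, so `v₂` is not a collider and, being in the boundary,
        -- blocks the path.
        exact o₂.2 (fun h => hG.asymm hcol.2 h.1) hv₂

/-- A set that d-separates `T` from all remaining vertices contains the Markov boundary of `T`. -/
theorem IsDAG.markovBoundary_subset_of_dSep [Fintype ι] [DecidableEq ι] (hG : IsDAG G) {T : ι}
    {S : Finset ι} (h : DSep G {T} (Finset.univ.erase T \ S) S) :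
    markovBoundary G T ⊆ S := by
  have hnbr : ∀ v, G.Adj v T ∨ G.Adj T v → v ∈ S := by
    intro v hv
    by_contra hvS
    have hne : T ≠ v := by
      rintro rfl
      exact hv.elim (hG.irrefl _) (hG.irrefl _)
    have hadj : G.toSimpleGraphInclusive.Adj T v := skeleton_adj.2 ⟨hne, hv.symm⟩
    -- A single edge has no interior vertex, so nothing can block it.
    refine h T (by simp) v (by simp [hvS, hne.symm]) hadj.toWalk ?_ ?_
    · simp [SimpleGraph.Adj.toWalk, SimpleGraph.Walk.cons_isPath_iff, hne]
    · intro k hk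
      simp at hk
  intro v hv
  rcases mem_markovBoundary.1 hv with hv | hv | ⟨hne, c, hTc, hvc⟩
  · exact hnbr v (.inl hv)
  · exact hnbr v (.inr hv)
  by_contra hvS
  have hTc' : T ≠ c := by rintro rfl; exact hG.irrefl _ hTc
  have hvc' : c ≠ v := by rintro rfl; exact hG.irrefl _ hvc
  have h₁ : G.toSimpleGraphInclusive.Adj T c := skeleton_adj.2 ⟨hTc', .inl hTc⟩
  have h₂ : G.toSimpleGraphInclusive.Adj c v := skeleton_adj.2 ⟨hvc', .inr hvc⟩
  -- The path `T → c ← v` is open because the collider `c`, a child of `T`, is already known to lie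
  -- in `S`.
  refine h T (by simp) v (by simp [hvS, hne]) (.cons h₁ (.cons h₂ .nil)) ?_ ?_
  · simp [SimpleGraph.Walk.cons_isPath_iff, hTc', hvc', hne.symm]
  · intro k hk
    obtain rfl : k = 0 := by simpa using hk
    refine ⟨fun _ => ⟨c, hnbr c (.inr hTc), .refl⟩, fun hn => ?_⟩
    exact absurd ⟨hTc, hvc⟩ hn

end Graph

/-! ### Conditional laws through densities -/

section Disintegration

open scoped ENNReal

variable {Ω α β γ : Type*} [MeasurableSpace Ω] [MeasurableSpace α] [MeasurableSpace β]
  [MeasurableSpace γ]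

/-- The density of the first marginal is obtained by integrating out the second variable. -/
theorem rnDeriv_map_fst_ae_eq (ρ : Measure (γ × α)) [IsFiniteMeasure ρ] (ν : Measure γ)
    [SigmaFinite ν] (l : Measure α) [SigmaFinite l] (hρ : ρ ≪ ν.prod l) :
    (ρ.map Prod.fst).rnDeriv ν =ᵐ[ν] fun c => ∫⁻ t, ρ.rnDeriv (ν.prod l) (c, t) ∂l := by
  have hm : Measurable (ρ.rnDeriv (ν.prod l)) := Measure.measurable_rnDeriv _ _
  have h : ρ.map Prod.fst = ν.withDensity fun c => ∫⁻ t, ρ.rnDeriv (ν.prod l) (c, t) ∂l := by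
    ext s hs
    rw [Measure.map_apply measurable_fst hs, withDensity_apply _ hs]
    conv_lhs => rw [← Measure.withDensity_rnDeriv_eq _ _ hρ]
    rw [withDensity_apply _ (measurable_fst hs), ← Set.prod_univ, setLIntegral_prod _ hm.aemeasurable]
    simp
  conv_lhs => rw [h]
  exact Measure.rnDeriv_withDensity _ hm.lintegral_prod_right'

/-- The conditional law of `X` given `Z` has the conditional density `p(x, z) / p(z)`. -/
theorem condDistrib_ae_eq_withDensity [StandardBorelSpace α] [Nonempty α]
    (P : Measure Ω) [IsProbabilityMeasure P] {X : Ω → α} {Z : Ω → γ}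
    (hX : Measurable X) (hZ : Measurable Z) (ν : Measure γ) [SigmaFinite ν]
    (l : Measure α) [SigmaFinite l] (hac : P.map (fun ω => (Z ω, X ω)) ≪ ν.prod l) :
    ∀ᵐ c ∂P.map Z, condDistrib X Z P c = l.withDensity fun t =>
      (P.map fun ω => (Z ω, X ω)).rnDeriv (ν.prod l) (c, t) / (P.map Z).rnDeriv ν c := by
  set ρ := P.map fun ω => (Z ω, X ω) with hρdef
  have hZX : Measurable fun ω => (Z ω, X ω) := hZ.prodMk hX
  have : IsProbabilityMeasure ρ := Measure.isProbabilityMeasure_map hZX.aemeasurable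
  have : IsProbabilityMeasure (P.map Z) := Measure.isProbabilityMeasure_map hZ.aemeasurable
  have hfst : ρ.map Prod.fst = P.map Z := Measure.map_map measurable_fst hZX
  set f := ρ.rnDeriv (ν.prod l) with hf
  set p := (P.map Z).rnDeriv ν with hp
  have hfm : Measurable f := Measure.measurable_rnDeriv _ _
  have hpm : Measurable p := Measure.measurable_rnDeriv _ _
  have hpf : p =ᵐ[ν] fun c => ∫⁻ t, f (c, t) ∂l := by
    rw [hp, ← hfst]
    exact rnDeriv_map_fst_ae_eq ρ ν l hac
  have hZac : P.map Z ≪ ν := by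
    rw [← hfst]
    exact (hac.map measurable_fst).trans Measure.quasiMeasurePreserving_fst.absolutelyContinuous
  have hhm : Measurable fun c : γ × α => f c / p c.1 := hfm.div (hpm.comp measurable_fst)
  -- Setting the quotient to zero off `D` gives a kernel of mass at most one everywhere, as
  -- uniqueness of disintegration needs a finite kernel. Almost every value of `Z` lies in `D`.
  let D : Set γ := {c | ∫⁻ t, f (c, t) / p c ∂l ≤ 1}
  have hD : MeasurableSet D := measurableSet_le hhm.lintegral_prod_right' measurable_const
  let k : γ → α → ℝ≥0∞ := fun c t => D.indicator (fun _ => f (c, t) / p c) c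
  have hkm : Measurable (Function.uncurry k) := by
    have : Function.uncurry k = (Prod.fst ⁻¹' D).indicator fun c : γ × α => f c / p c.1 := by
      ext ⟨c, t⟩
      simp [k, Set.indicator]
    rw [this]
    exact hhm.indicator (measurable_fst hD)
  let K : Kernel γ α := Kernel.withDensity (Kernel.const γ l) k
  have hK : ∀ c, K c = l.withDensity (k c) := fun c => by
    simp [K, Kernel.withDensity_apply _ hkm]
  have : IsFiniteKernel K := by
    refine ⟨⟨1, ENNReal.one_lt_top, fun c => ?_⟩⟩
    rw [hK, withDensity_apply _ MeasurableSet.univ, Measure.restrict_univ]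
    by_cases hc : c ∈ D
    · simp only [k, Set.indicator_of_mem hc]
      exact hc
    · simp [k, hc]
  have hgood : ∀ᵐ c ∂ν, p c ≠ ∞ ∧ ∫⁻ t, f (c, t) ∂l = p c := by
    filter_upwards [hpf, Measure.rnDeriv_ne_top (P.map Z) ν] with c h1 h2 using ⟨h2, h1.symm⟩
  have hcomp : ρ = P.map Z ⊗ₘ K := by
    ext s hs
    rw [Measure.compProd_apply hs, ← lintegral_rnDeriv_mul hZac
      (Kernel.measurable_kernel_prodMk_left hs).aemeasurable]
    conv_lhs => rw [← Measure.withDensity_rnDeriv_eq _ _ hac]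
    rw [withDensity_apply _ hs, ← lintegral_indicator hs,
      lintegral_prod _ (hfm.indicator hs).aemeasurable]
    refine lintegral_congr_ae ?_
    filter_upwards [hgood] with c ⟨hc1, hc2⟩
    have hsc : MeasurableSet (Prod.mk c ⁻¹' s) := measurable_prodMk_left hs
    have hind : ∀ t, s.indicator f (c, t) = (Prod.mk c ⁻¹' s).indicator (fun t => f (c, t)) t :=
      fun t => rfl
    change _ = p c * _
    have hft : Measurable fun t => f (c, t) := hfm.comp measurable_prodMk_left
    have hkc : Measurable (k c) := hkm.comp measurable_prodMk_left
    simp only [hind]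
    rw [lintegral_indicator hsc, hK, withDensity_apply _ hsc, ← lintegral_const_mul _ hkc]
    -- Where `p c = 0` the quotient may be infinite, but `f (c, ·)` has integral zero and both sides
    -- vanish.
    by_cases h0 : p c = 0
    · rw [h0] at hc2 ⊢
      have h1 : ∫⁻ t in Prod.mk c ⁻¹' s, f (c, t) ∂l = 0 :=
        le_antisymm ((setLIntegral_le_lintegral _ _).trans hc2.le) (zero_le)
      simp [h1]
    · have hcD : c ∈ D := by
        simp only [D, Set.mem_ofPred_eq, div_eq_mul_inv]
        rw [lintegral_mul_const _ hft, hc2, ENNReal.mul_inv_cancel h0 hc1]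
      refine lintegral_congr fun t => ?_
      simp only [k, Set.indicator_of_mem hcD]
      rw [ENNReal.mul_div_cancel h0 hc1]
  filter_upwards [condDistrib_ae_eq_of_measure_eq_compProd Z hX.aemeasurable hcomp,
    hZac.ae_le hgood, Measure.rnDeriv_pos hZac] with c hc ⟨hc1, hc2⟩ hc3
  rw [hc, hK]
  have hft : Measurable fun t => f (c, t) := hfm.comp measurable_prodMk_left
  have hcD : c ∈ D := by
    simp only [D, Set.mem_ofPred_eq, div_eq_mul_inv]
    rw [lintegral_mul_const _ hft, hc2, ENNReal.mul_inv_cancel hc3.ne' hc1]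
  simp only [k, Set.indicator_of_mem hcD]

/-- The joint law that has the same `(z, x)`- and `(z, y)`-marginals and makes `x` and `y`
conditionally independent given `z`. -/
def condIndepLaw [StandardBorelSpace α] [Nonempty α] [StandardBorelSpace β] [Nonempty β]
    (P : Measure Ω) [IsFiniteMeasure P] (X : Ω → α) (Y : Ω → β) (Z : Ω → γ) :
    Measure (γ × α × β) :=
  P.map Z ⊗ₘ (condDistrib X Z P ×ₖ condDistrib Y Z P)

theorem condIndepFun_iff_map_eq_condIndepLaw [StandardBorelSpace Ω]
    [StandardBorelSpace α] [Nonempty α] [StandardBorelSpace β] [Nonempty β]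
    (P : Measure Ω) [IsFiniteMeasure P] {X : Ω → α} {Y : Ω → β} {Z : Ω → γ}
    (hX : Measurable X) (hY : Measurable Y) (hZ : Measurable Z) :
    CondIndepFun (MeasurableSpace.comap Z inferInstance) hZ.comap_le X Y P ↔
      P.map (fun ω => (Z ω, X ω, Y ω)) = condIndepLaw P X Y Z := by
  rw [condIndepFun_iff_map_prod_eq_prod_condDistrib_prod_condDistrib hX hY hZ, condIndepLaw,
    Measure.compProd_eq_comp_prod]

/-- Multiply the two conditional densities and integrate against the law of `Z`. The factors `p` are
left uncancelled, which avoids a case distinction where `p` is zero or infinite. -/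
theorem condIndepLaw_eq_withDensity
    [StandardBorelSpace α] [Nonempty α] [StandardBorelSpace β] [Nonempty β]
    (P : Measure Ω) [IsProbabilityMeasure P] {X : Ω → α} {Y : Ω → β} {Z : Ω → γ}
    (hX : Measurable X) (hY : Measurable Y) (hZ : Measurable Z)
    (ν : Measure γ) [SigmaFinite ν] (l : Measure α) [SigmaFinite l]
    (m : Measure β) [SigmaFinite m]
    (hacX : P.map (fun ω => (Z ω, X ω)) ≪ ν.prod l)
    (hacY : P.map (fun ω => (Z ω, Y ω)) ≪ ν.prod m) (hacZ : P.map Z ≪ ν) :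
    condIndepLaw P X Y Z = (ν.prod (l.prod m)).withDensity fun c =>
      (P.map Z).rnDeriv ν c.1 *
      (((P.map fun ω => (Z ω, X ω)).rnDeriv (ν.prod l) (c.1, c.2.1) / (P.map Z).rnDeriv ν c.1) *
      ((P.map fun ω => (Z ω, Y ω)).rnDeriv (ν.prod m) (c.1, c.2.2) /
        (P.map Z).rnDeriv ν c.1)) := by
  set f := (P.map fun ω => (Z ω, X ω)).rnDeriv (ν.prod l)
  set g := (P.map fun ω => (Z ω, Y ω)).rnDeriv (ν.prod m)
  set p := (P.map Z).rnDeriv ν with hp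
  have hfm : Measurable f := Measure.measurable_rnDeriv _ _
  have hgm : Measurable g := Measure.measurable_rnDeriv _ _
  have hpm : Measurable p := Measure.measurable_rnDeriv _ _
  have : IsProbabilityMeasure (P.map Z) := Measure.isProbabilityMeasure_map hZ.aemeasurable
  have hdm : Measurable fun c : γ × α × β =>
      p c.1 * ((f (c.1, c.2.1) / p c.1) * (g (c.1, c.2.2) / p c.1)) := by
    fun_prop
  have hem : Measurable fun c : γ × α × β =>
      (f (c.1, c.2.1) / p c.1) * (g (c.1, c.2.2) / p c.1) := by
    fun_prop
  ext s hs
  have hind : ∀ (F : γ × α × β → ℝ≥0∞) c t,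
    s.indicator F (c, t) = (Prod.mk c ⁻¹' s).indicator (fun t => F (c, t)) t := fun _ _ _ => rfl
  rw [condIndepLaw, Measure.compProd_apply hs, withDensity_apply _ hs, ← lintegral_indicator hs,
    lintegral_prod _ (hdm.indicator hs).aemeasurable]
  have hstep : ∀ᵐ c ∂P.map Z,
      (condDistrib X Z P ×ₖ condDistrib Y Z P) c (Prod.mk c ⁻¹' s) =
      ∫⁻ t in Prod.mk c ⁻¹' s, (f (c, t.1) / p c) * (g (c, t.2) / p c) ∂(l.prod m) := by
    filter_upwards [condDistrib_ae_eq_withDensity P hX hZ ν l hacX,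
      condDistrib_ae_eq_withDensity P hY hZ ν m hacY] with c h1 h2
    have hsc : MeasurableSet (Prod.mk c ⁻¹' s) := measurable_prodMk_left hs
    rw [Kernel.prod_apply, h1, h2, prod_withDensity (by fun_prop) (by fun_prop),
      withDensity_apply _ hsc]
  rw [lintegral_congr_ae hstep]
  have hmeas : Measurable fun c => ∫⁻ t in Prod.mk c ⁻¹' s,
      (f (c, t.1) / p c) * (g (c, t.2) / p c) ∂(l.prod m) := by
    have := (hem.indicator hs).lintegral_prod_right' (ν := l.prod m)
    convert this using 2 with c
    simp only [hind]
    rw [lintegral_indicator (measurable_prodMk_left hs)]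
  rw [← lintegral_rnDeriv_mul hacZ hmeas.aemeasurable]
  refine lintegral_congr fun c => ?_
  simp only [hind]
  rw [lintegral_indicator (measurable_prodMk_left hs), lintegral_const_mul _ (by fun_prop)]

end Disintegration

/-! ### Conditional mutual information as a Kullback-Leibler divergence -/

section ConditionalMutualInformation

open scoped ENNReal
open InformationTheory

variable {Ω α β γ : Type*} [MeasurableSpace Ω] [MeasurableSpace α] [MeasurableSpace β]
  [MeasurableSpace γ]

/-- A null set of the weighted measure meets `{g ≠ 0}` in a `μ`-null, hence `ρ`-null, set; the rest
of it lies in `{g = 0}`, which is `ρ`-null. -/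
theorem absolutelyContinuous_withDensity_of_ae_ne_zero {μ ρ : Measure α} (hρ : ρ ≪ μ)
    {g : α → ℝ≥0∞} (hg : Measurable g) (h : ∀ᵐ x ∂ρ, g x ≠ 0) : ρ ≪ μ.withDensity g := by
  refine Measure.AbsolutelyContinuous.mk fun s _ h0 => ?_
  rw [withDensity_apply_eq_zero hg] at h0
  have h1 := hρ h0
  rw [← measure_inter_add_sdiff₀ s (measurableSet_preimage hg (measurableSet_singleton 0).compl
    |>.nullMeasurableSet (μ := ρ))]
  have h2 : ρ (s \ g ⁻¹' {0}ᶜ) = 0 := measure_mono_null (fun x hx => by simpa using hx.2) h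
  rw [h2, add_zero, Set.inter_comm]
  exact h1

/-- The expected logarithm of the conditional density of `X` given `Z` is at most that of `X` given
`(Z, Y)`, with equality iff `X` and `Y` are conditionally independent given `Z`: the difference is
the conditional mutual information, a Kullback-Leibler divergence. -/
theorem integral_log_condDensity_le [StandardBorelSpace Ω]
    [StandardBorelSpace α] [Nonempty α] [StandardBorelSpace β] [Nonempty β]
    (P : Measure Ω) [IsProbabilityMeasure P] {X : Ω → α} {Y : Ω → β} {Z : Ω → γ}
    (hX : Measurable X) (hY : Measurable Y) (hZ : Measurable Z)
    (ν : Measure γ) [SigmaFinite ν] (l : Measure α) [SigmaFinite l]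
    (m : Measure β) [SigmaFinite m]
    (hac : P.map (fun ω => (Z ω, X ω, Y ω)) ≪ ν.prod (l.prod m))
    (hacX : P.map (fun ω => (Z ω, X ω)) ≪ ν.prod l)
    (hacY : P.map (fun ω => (Z ω, Y ω)) ≪ ν.prod m) (hacZ : P.map Z ≪ ν)
    {L₁ L₂ : Ω → ℝ}
    (hL₁ : L₁ =ᵐ[P] fun ω => Real.log
      (((P.map fun ω => (Z ω, X ω)).rnDeriv (ν.prod l) (Z ω, X ω)).toReal /
        ((P.map Z).rnDeriv ν (Z ω)).toReal))
    (hL₂ : L₂ =ᵐ[P] fun ω => Real.log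
      (((P.map fun ω => (Z ω, X ω, Y ω)).rnDeriv (ν.prod (l.prod m)) (Z ω, X ω, Y ω)).toReal /
        ((P.map fun ω => (Z ω, Y ω)).rnDeriv (ν.prod m) (Z ω, Y ω)).toReal))
    (hi₁ : Integrable L₁ P) (hi₂ : Integrable L₂ P) :
    ∫ ω, L₁ ω ∂P ≤ ∫ ω, L₂ ω ∂P ∧
      (∫ ω, L₁ ω ∂P = ∫ ω, L₂ ω ∂P ↔
        CondIndepFun (MeasurableSpace.comap Z inferInstance) hZ.comap_le X Y P) := by
  rw [condIndepFun_iff_map_eq_condIndepLaw P hX hY hZ]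
  have hQ := condIndepLaw_eq_withDensity P hX hY hZ ν l m hacX hacY hacZ
  have hF : Measurable fun ω => (Z ω, X ω, Y ω) := by fun_prop
  have hZX : Measurable fun ω => (Z ω, X ω) := by fun_prop
  have hZY : Measurable fun ω => (Z ω, Y ω) := by fun_prop
  set R := P.map fun ω => (Z ω, X ω, Y ω) with hR
  set Q := condIndepLaw P X Y Z with hQdef
  set M := ν.prod (l.prod m)
  set f := (P.map fun ω => (Z ω, X ω)).rnDeriv (ν.prod l)
  set g := (P.map fun ω => (Z ω, Y ω)).rnDeriv (ν.prod m)
  set p := (P.map Z).rnDeriv ν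
  have hfm : Measurable f := Measure.measurable_rnDeriv _ _
  have hgm : Measurable g := Measure.measurable_rnDeriv _ _
  have hpm : Measurable p := Measure.measurable_rnDeriv _ _
  have : IsProbabilityMeasure (P.map Z) := Measure.isProbabilityMeasure_map hZ.aemeasurable
  have : IsProbabilityMeasure (P.map fun ω => (Z ω, X ω)) :=
    Measure.isProbabilityMeasure_map hZX.aemeasurable
  have : IsProbabilityMeasure (P.map fun ω => (Z ω, Y ω)) :=
    Measure.isProbabilityMeasure_map hZY.aemeasurable
  have : IsProbabilityMeasure R := Measure.isProbabilityMeasure_map hF.aemeasurable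
  have : IsProbabilityMeasure Q := by rw [hQdef, condIndepLaw]; infer_instance
  set q : γ × α × β → ℝ≥0∞ := fun c =>
    p c.1 * ((f (c.1, c.2.1) / p c.1) * (g (c.1, c.2.2) / p c.1)) with hq
  have hqm : Measurable q := by fun_prop
  have hf1 : ∀ᵐ ω ∂P, 0 < f (Z ω, X ω) ∧ f (Z ω, X ω) < ∞ :=
    ae_of_ae_map hZX.aemeasurable (p := fun c => 0 < f c ∧ f c < ∞)
      ((Measure.rnDeriv_pos hacX).and (hacX.ae_le (Measure.rnDeriv_lt_top _ _)))
  have hg1 : ∀ᵐ ω ∂P, 0 < g (Z ω, Y ω) ∧ g (Z ω, Y ω) < ∞ :=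
    ae_of_ae_map hZY.aemeasurable (p := fun c => 0 < g c ∧ g c < ∞)
      ((Measure.rnDeriv_pos hacY).and (hacY.ae_le (Measure.rnDeriv_lt_top _ _)))
  have hp1 : ∀ᵐ ω ∂P, 0 < p (Z ω) ∧ p (Z ω) < ∞ :=
    ae_of_ae_map hZ.aemeasurable (p := fun c => 0 < p c ∧ p c < ∞)
      ((Measure.rnDeriv_pos hacZ).and (hacZ.ae_le (Measure.rnDeriv_lt_top _ _)))
  have hr1 : ∀ᵐ ω ∂P, 0 < R.rnDeriv M (Z ω, X ω, Y ω) ∧ R.rnDeriv M (Z ω, X ω, Y ω) < ∞ :=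
    ae_of_ae_map hF.aemeasurable (p := fun c => 0 < R.rnDeriv M c ∧ R.rnDeriv M c < ∞)
      ((Measure.rnDeriv_pos hac).and (hac.ae_le (Measure.rnDeriv_lt_top _ _)))
  have hRQ : R ≪ Q := by
    rw [hQ]
    refine absolutelyContinuous_withDensity_of_ae_ne_zero hac hqm ?_
    refine (ae_map_iff hF.aemeasurable
      (measurableSet_preimage hqm (measurableSet_singleton 0).compl)).2 ?_
    filter_upwards [hf1, hg1, hp1] with ω h1 h2 h3
    refine mul_ne_zero h3.1.ne' (mul_ne_zero ?_ ?_)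
    · exact (ENNReal.div_pos h1.1.ne' h3.2.ne).ne'
    · exact (ENNReal.div_pos h2.1.ne' h3.2.ne).ne'
  -- Chain rule: `dR/dQ · q = dR/dM`, where `q` equals `f g / p` almost surely, so the logarithm of
  -- `dR/dQ` splits into the two log conditional densities.
  have hllr : (fun ω => llr R Q (Z ω, X ω, Y ω)) =ᵐ[P] fun ω => L₂ ω - L₁ ω := by
    have h4 : R.rnDeriv Q * Q.rnDeriv M =ᵐ[M] R.rnDeriv M := Measure.rnDeriv_mul_rnDeriv hRQ
    have h5 : Q.rnDeriv M =ᵐ[M] q := by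
      rw [hQ]
      exact Measure.rnDeriv_withDensity _ hqm
    have h6 : ∀ᵐ ω ∂P, R.rnDeriv Q (Z ω, X ω, Y ω) * q (Z ω, X ω, Y ω) =
        R.rnDeriv M (Z ω, X ω, Y ω) := by
      refine ae_of_ae_map hF.aemeasurable (p := fun c => R.rnDeriv Q c * q c = R.rnDeriv M c)
        (hac.ae_le ?_)
      filter_upwards [h4, h5] with c h4 h5
      rw [← h4, ← h5, Pi.mul_apply]
    filter_upwards [hf1, hg1, hp1, hr1, h6, hL₁, hL₂] with ω h1 h2 h3 hr h6 hL₁ hL₂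
    have a1 := ENNReal.toReal_pos h1.1.ne' h1.2.ne
    have a2 := ENNReal.toReal_pos h2.1.ne' h2.2.ne
    have a3 := ENNReal.toReal_pos h3.1.ne' h3.2.ne
    have ar := ENNReal.toReal_pos hr.1.ne' hr.2.ne
    rw [hL₁, hL₂, llr_def, ← Real.log_div (div_pos ar a2).ne' (div_pos a1 a3).ne']
    rw [← h6]
    simp only [hq, ENNReal.toReal_mul, ENNReal.toReal_div]
    field_simp
  have hsm : AEStronglyMeasurable (llr R Q) R := (stronglyMeasurable_llr R Q).aestronglyMeasurable
  have hint : Integrable (llr R Q) R := by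
    rw [hR, integrable_map_measure hsm hF.aemeasurable]
    exact (integrable_congr hllr).2 (hi₂.sub hi₁)
  have hkl : (klDiv R Q).toReal = ∫ ω, L₂ ω ∂P - ∫ ω, L₁ ω ∂P := by
    rw [toReal_klDiv_of_measure_eq hRQ (by simp), ← integral_sub hi₂ hi₁,
      ← integral_congr_ae hllr, hR, integral_map hF.aemeasurable hsm]
  -- Finiteness is needed since `toReal` also sends `∞` to zero.
  have hne : klDiv R Q ≠ ∞ := klDiv_ne_top hRQ hint
  have h0 : (0 : ℝ) ≤ (klDiv R Q).toReal := ENNReal.toReal_nonneg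
  refine ⟨by linarith, ?_⟩
  rw [← klDiv_eq_zero_iff]
  constructor
  · intro h
    have : (klDiv R Q).toReal = 0 := by linarith
    exact ((ENNReal.toReal_eq_zero_iff _).1 this).resolve_right hne
  · intro h
    rw [h, ENNReal.toReal_zero] at hkl
    linarith

end ConditionalMutualInformation

/-! ### From abstract random variables to coordinate blocks -/

section Entropy

theorem piFinsetUnion_restrict {ι : Type*} [DecidableEq ι] {E : ι → Type*}
    [∀ i, MeasurableSpace (E i)] {A B : Finset ι} (h : Disjoint A B)
    (x : ∀ i, E i) :
    MeasurableEquiv.piFinsetUnion E h (A.restrict x, B.restrict x) = (A ∪ B).restrict x := by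
  ext ⟨i, hi⟩
  rcases Finset.mem_union.1 hi with hi' | hi'
  · exact Equiv.piFinsetUnion_left E h hi' hi
  · exact Equiv.piFinsetUnion_right E h hi' hi

variable {ι : Type*} [Fintype ι] {E : ι → Type*} [∀ i, MeasurableSpace (E i)]
  (ν : ∀ i, Measure (E i)) [∀ i, SigmaFinite (ν i)]
  (P : Measure (∀ i, E i)) [IsProbabilityMeasure P]

/-- Projecting the reference product may multiply the smaller product by an infinite mass, but it
still respects null sets, which is all that is used. -/
theorem map_restrict_absolutelyContinuous [DecidableEq ι] {P : Measure (∀ i, E i)}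
    (hP : P ≪ Measure.pi ν) (S : Finset ι) :
    P.map (S.restrict (π := E)) ≪ Measure.pi fun i : S => ν i := by
  have h1 := measurePreserving_piEquivPiSubtypeProd ν (· ∈ S)
  have h2 : Measure.QuasiMeasurePreserving (S.restrict (π := E)) (Measure.pi ν)
      (Measure.pi fun i : S => ν i) := by
    have := Measure.quasiMeasurePreserving_fst.comp h1.quasiMeasurePreserving
    convert! this
  exact (hP.map (Finset.measurable_restrict S)).trans h2.absolutelyContinuous

/-- The density of a subvector may be computed in any coordinates that preserve the reference
measures. -/
theorem density_ae_eq [DecidableEq ι] (hP : P ≪ Measure.pi ν) (S : Finset ι) {W : Type*}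
    [MeasurableSpace W] (m : Measure W) [SigmaFinite m] (e : W ≃ᵐ ∀ i : S, E i)
    (he : MeasurePreserving e m (Measure.pi fun i : S => ν i)) {F : (∀ i, E i) → W}
    (hF : Measurable F) (hFe : ∀ x, e (F x) = S.restrict x) :
    P.map F ≪ m ∧
      density ν P S =ᵐ[P] fun x => ((P.map F).rnDeriv m (F x)).toReal := by
  have hmap : P.map (S.restrict (π := E)) = (P.map F).map e := by
    rw [Measure.map_map e.measurable hF]
    exact congrArg P.map (funext fun x => (hFe x).symm)
  have hac : P.map F ≪ m := by
    have h := (map_restrict_absolutelyContinuous ν hP S).map e.symm.measurable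
    rw [hmap, Measure.map_map e.symm.measurable e.measurable, ← he.map_eq,
      Measure.map_map e.symm.measurable e.measurable] at h
    simpa using h
  have : IsProbabilityMeasure (P.map F) := Measure.isProbabilityMeasure_map hF.aemeasurable
  refine ⟨hac, ?_⟩
  have h := ae_of_ae_map hF.aemeasurable
    (hac.ae_le (e.measurableEmbedding.rnDeriv_map (P.map F) m))
  filter_upwards [h] with x hx
  rw [density, hmap, ← he.map_eq, ← hFe, hx]

/-- Conditioning on more variables does not increase the entropy, and does not change it exactly
when the additional variables are conditionally independent of `T`. -/
theorem condEntropy_union_le [DecidableEq ι] [∀ i, StandardBorelSpace (E i)]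
    (hP : P ≪ Measure.pi ν) {T : ι} {S B : Finset ι} (hTS : T ∉ S) (hTB : T ∉ B)
    (hSB : Disjoint S B) (h₁ : Integrable (logCondDensity ν P T S) P)
    (h₂ : Integrable (logCondDensity ν P T (S ∪ B)) P) :
    condEntropy ν P T (S ∪ B) ≤ condEntropy ν P T S ∧
      (condEntropy ν P T (S ∪ B) = condEntropy ν P T S ↔ CondIndepVars P {T} B S) := by
  have hne : Nonempty (∀ i, E i) := nonempty_of_isProbabilityMeasure P
  have hneE : ∀ i, Nonempty (E i) := fun i => hne.map fun x => x i
  have hST : Disjoint S {T} := by simpa using hTS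
  have hTB' : Disjoint {T} B := by simpa using hTB
  have hSTB : Disjoint S ({T} ∪ B) := Finset.disjoint_union_right.2 ⟨hST, hSB⟩
  have hmS := Finset.measurable_restrict (X := E) S
  have hmT := Finset.measurable_restrict (X := E) {T}
  have hmB := Finset.measurable_restrict (X := E) B
  have eqT : insert T S = S ∪ {T} := by ext; simp
  have eqTB : insert T (S ∪ B) = S ∪ ({T} ∪ B) := by ext; simp
  obtain ⟨acX, dX⟩ := density_ae_eq ν P hP (S ∪ {T}) _ _ (measurePreserving_piFinsetUnion hST ν)
    (hmS.prodMk hmT) (piFinsetUnion_restrict hST)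
  obtain ⟨acY, dY⟩ := density_ae_eq ν P hP (S ∪ B) _ _ (measurePreserving_piFinsetUnion hSB ν)
    (hmS.prodMk hmB) (piFinsetUnion_restrict hSB)
  obtain ⟨acA, dA⟩ := density_ae_eq ν P hP (S ∪ ({T} ∪ B))
    ((Measure.pi fun i : S => ν i).prod
      ((Measure.pi fun i : ({T} : Finset ι) => ν i).prod (Measure.pi fun i : B => ν i)))
    ((MeasurableEquiv.prodCongr (.refl _) (MeasurableEquiv.piFinsetUnion E hTB')).trans
      (MeasurableEquiv.piFinsetUnion E hSTB))
    ((measurePreserving_piFinsetUnion hSTB ν).comp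
      ((MeasurePreserving.id _).prod (measurePreserving_piFinsetUnion hTB' ν)))
    (hmS.prodMk (hmT.prodMk hmB)) (fun x => by
      rw [← piFinsetUnion_restrict hSTB, ← piFinsetUnion_restrict hTB']
      rfl)
  have key := integral_log_condDensity_le P hmT hmB hmS (Measure.pi fun i : S => ν i)
    (Measure.pi fun i : ({T} : Finset ι) => ν i) (Measure.pi fun i : B => ν i) acA acX acY
    (map_restrict_absolutelyContinuous ν hP S)
    (L₁ := logCondDensity ν P T S) (L₂ := logCondDensity ν P T (S ∪ B))
    (by
      filter_upwards [dX] with x hx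
      rw [logCondDensity, eqT, hx]
      rfl)
    (by
      filter_upwards [dA, dY] with x hx hy
      rw [logCondDensity, eqTB, hx, hy])
    h₁ h₂
  simp only [condEntropy, neg_le_neg_iff, neg_inj]
  exact ⟨key.1, eq_comm.trans key.2⟩

end Entropy
end MarkovBoundary

end

/-! ### The Markov boundary as least minimizer -/

theorem theorem1 {ι : Type*} [Fintype ι] [DecidableEq ι]
    {E : ι → Type*} [∀ i, MeasurableSpace (E i)] [∀ i, StandardBorelSpace (E i)]
    (ν : ∀ i, Measure (E i)) [∀ i, SigmaFinite (ν i)]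
    (P : Measure (∀ i, E i)) [IsProbabilityMeasure P] (hP : P ≪ Measure.pi ν)
    (G : Digraph ι) (hG : MarkovBoundary.IsDAG G) (hF : MarkovBoundary.Faithful G P)
    (T : ι)
    (hfin : ∀ S ⊆ Finset.univ.erase T, Integrable (MarkovBoundary.logCondDensity ν P T S) P) :
    (∀ S : Finset ι, Minimal (MarkovBoundary.MinimizesCondEntropy ν P T) S ↔
      S = MarkovBoundary.markovBoundary G T) ∧
    (∀ S' ⊆ Finset.univ.erase T, MarkovBoundary.markovBoundary G T ⊆ S' →
      MarkovBoundary.condEntropy ν P T S' =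
        MarkovBoundary.condEntropy ν P T (MarkovBoundary.markovBoundary G T)) := by
  open MarkovBoundary in
  have hmono : ∀ S S', S ⊆ S' → S' ⊆ Finset.univ.erase T →
      condEntropy ν P T S' ≤ condEntropy ν P T S ∧
      (condEntropy ν P T S' = condEntropy ν P T S ↔ DSep G {T} (S' \ S) S) := by
    intro S S' hSS' hS'
    have hTS' : T ∉ S' := fun h => by simpa using hS' h
    have hTS : T ∉ S := fun h => hTS' (hSS' h)
    have hTB : T ∉ S' \ S := fun h => hTS' (Finset.mem_sdiff.1 h).1
    have hU : S ∪ S' \ S = S' := Finset.union_sdiff_of_subset hSS'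
    have h := condEntropy_union_le ν P hP hTS hTB Finset.disjoint_sdiff
      (hfin S (hSS'.trans hS')) (by rw [hU]; exact hfin S' hS')
    rwa [hU, hF {T} (S' \ S) S (by simpa using hTB) (by simpa using hTS)
      Finset.sdiff_disjoint] at h
  have hM := hG.markovBoundary_subset T
  have heq : ∀ S' ⊆ Finset.univ.erase T, MarkovBoundary.markovBoundary G T ⊆ S' →
      MarkovBoundary.condEntropy ν P T S' =
        MarkovBoundary.condEntropy ν P T (MarkovBoundary.markovBoundary G T) :=
    fun S' hS' hMS' => (hmono _ S' hMS' hS').2.2 (hG.dSep_markovBoundary T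
      Finset.sdiff_disjoint fun h => by simpa using hS' (Finset.mem_sdiff.1 h).1)
  -- Every `S` is compared with the full set `univ.erase T`, whose entropy the boundary attains.
  have hmin : MarkovBoundary.MinimizesCondEntropy ν P T (MarkovBoundary.markovBoundary G T) :=
    ⟨hM, fun S hS => (heq _ subset_rfl hM).symm.le.trans (hmono S _ hS subset_rfl).1⟩
  -- A minimizer ties with the full set, and the equality case turns this tie into d-separation from
  -- all the rest.
  have hsub : ∀ S, MarkovBoundary.MinimizesCondEntropy ν P T S →
      MarkovBoundary.markovBoundary G T ⊆ S := fun S hS =>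
    hG.markovBoundary_subset_of_dSep <| (hmono S _ hS.1 subset_rfl).2.1 <|
      le_antisymm (hmono S _ hS.1 subset_rfl).1 (hS.2 _ subset_rfl)
  refine ⟨fun S => ⟨fun hS => ?_, ?_⟩, heq⟩
  · exact le_antisymm (hS.2 hmin (hsub S hS.1)) (hsub S hS.1)
  · rintro rfl
    exact ⟨hmin, fun S hS _ => hsub S hS⟩
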